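/- Let $\Sigma=\{A_j : j\in J\}$ be a finite family of real $n\times n$ matrices which is CP, that is: - (LCP) for every sequence $j_1,j_2,\dots$ in $J$, the products $A_{j_m}\cdots A_{j_1}$ converge as $m\to\infty$; - (RCP) for every sequence $j_1,j_2,\dots$ in $J$, the products $A_{j_1}\cdots A_{j_m}$ converge as $m\to\infty$; - (transversality) for every $J'\subseteq J$ one has $\mathbb R^n=N_{J'}\oplus R_{J'}$, where $N_{J'}=\bigcap_{j\in J'}\ker(I-A_j)$ and $R_{J'}=\operatorname{span}\bigcup_{j\in J'}\operatorname{range}(I-A_j)$ (so $N_\emptyset=\mathbb R^n$ and $R_\emptyset=\{0\}$). An insertion sequence over $J$ is a sequence of words $w_1,w_2,\dots$ in the alphabet $J$ such that $w_i$ has length $i$ and, for each $i\ge 1$, there are words $u,v$ and a letter $j\in J$ with $w_i=uv$ and $w_{i+1}=ujv$ ($u$ or $v$ may be empty). For a word $w=j_1\cdots j_m$, put $A_w=A_{j_1}\cdots A_{j_m}$. Let $\|\cdot\|$ be any norm on the space of real $n\times n$ matrices. Then there is a constant $V$, depending only on $\Sigma$ and the norm, such that for every insertion sequence $(w_i)$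 the matrices $M_i=A_{w_i}$ satisfy $$\sum_{i=1}^{\infty}\|M_{i+1}-M_i\|\le V .$$ -/

import Mathlib

namespace MatrixFamily

variable {J : Type*} {n : ℕ}

/-- `leftProd A s m = A_{s (m-1)} ⋯ A_{s 1} A_{s 0}`: each new factor is put on the left. -/
def leftProd (A : J → Matrix (Fin n) (Fin n) ℝ) (s : ℕ → J) : ℕ → Matrix (Fin n) (Fin n) ℝ
  | 0 => 1
  | m + 1 => A (s m) * leftProd A s m

/-- `rightProd A s m = A_{s 0} A_{s 1} ⋯ A_{s (m-1)}`: each new factor is put on the right. -/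
def rightProd (A : J → Matrix (Fin n) (Fin n) ℝ) (s : ℕ → J) : ℕ → Matrix (Fin n) (Fin n) ℝ
  | 0 => 1
  | m + 1 => rightProd A s m * A (s m)

/-- Left convergent products. The topology on matrices is the entrywise one, which is
the topology of every norm on the space of `n × n` matrices. -/
def IsLCP (A : J → Matrix (Fin n) (Fin n) ℝ) : Prop :=
  ∀ s : ℕ → J, ∃ L : Matrix (Fin n) (Fin n) ℝ,
    Filter.Tendsto (leftProd A s) Filter.atTop (nhds L)

/-- Right convergent products. -/
def IsRCP (A : J → Matrix (Fin n) (Fin n) ℝ) : Prop :=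
  ∀ s : ℕ → J, ∃ L : Matrix (Fin n) (Fin n) ℝ,
    Filter.Tendsto (rightProd A s) Filter.atTop (nhds L)

/-- The intersection over `j ∈ J'` of the null spaces of `I - A_j`. -/
def nullPart (A : J → Matrix (Fin n) (Fin n) ℝ) (J' : Set J) : Submodule ℝ (Fin n → ℝ) :=
  ⨅ j ∈ J', LinearMap.ker (Matrix.toLin' (1 - A j))

/-- The span of the ranges of `I - A_j` over `j ∈ J'`. -/
def rangePart (A : J → Matrix (Fin n) (Fin n) ℝ) (J' : Set J) : Submodule ℝ (Fin n → ℝ) :=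
  ⨆ j ∈ J', LinearMap.range (Matrix.toLin' (1 - A j))

/-- Transversality: the space is the direct sum of the two parts, for every set of indices. -/
def IsTransversal (A : J → Matrix (Fin n) (Fin n) ℝ) : Prop :=
  ∀ J' : Set J, IsCompl (nullPart A J') (rangePart A J')

/-- A CP family: left convergent products, right convergent products, and transversality. -/
structure IsCP (A : J → Matrix (Fin n) (Fin n) ℝ) : Prop where
  lcp : IsLCP A
  rcp : IsRCP A
  transversal : IsTransversal A

/-- The product `A_{j_1} ⋯ A_{j_m}` of the word `[j_1, …, j_m]`, in this order. -/
def wordProd (A : J → Matrix (Fin n) (Fin n) ℝ) (w : List J) : Matrix (Fin n) (Fin n) ℝ :=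
  (w.map A).prod

/-- A sequence of words `w 1, w 2, …` (the value `w 0` plays no role), where `w i` has length `i`
and `w (i + 1)` arises from `w i` by inserting one letter at some place, the front and
the rear included. -/
structure IsInsertionSequence (w : ℕ → List J) : Prop where
  length_eq : ∀ i, 1 ≤ i → (w i).length = i
  step : ∀ i, 1 ≤ i → ∃ (u v : List J) (j : J), w i = u ++ v ∧ w (i + 1) = u ++ j :: v

end MatrixFamily

namespace MatrixFamily

/-! The bound is proved for chains of insertions over a set `K` of letters, by strong induction on
`K`, in any finite-dimensional normed algebra.

Left convergence of a finite family bounds all its products by one constant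
(`LeftConvergent.exists_norm_le`). Transversality gives a projection `q` onto the range part,
commuting with the letters of `K`, whose complement `1 - q` they fix. If words with ever more blocks
(factors containing all of `K`) did not shrink `q`, compactness would give an infinite word using
each letter of `K` infinitely often. Its limit product is fixed by `K`, hence killed by `q`, a
contradiction. So `A_w q` decays geometrically in the number of blocks of `w` (`exists_decay`).

The number of blocks never drops along a chain. In the stage with exactly `k` blocks, the last word
is cut into at most `2k + 1` segments, each a single letter or a word missing a letter of `K`. The
cuts are pulled back along the chain, so that each insertion alters one segment. A change inside a
segment sees only the `q`-parts of what surrounds it, and so is damped by `C² r ^ (k - 3)`; the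
undamped variation of a segment is bounded by the induction hypothesis. Hence stage `k` contributes
at most `(2k + 1) C² r ^ (k - 3) V`, which is summable in `k`. -/

open Filter Topology

/-! ### Words, blocks and chains of insertions -/

section Words

variable {J : Type*}

/-- `HasBlocks K k w`: the word `w` is a concatenation in which `k` consecutive factors contain
every letter of `K`. -/
def HasBlocks (K : Finset J) : ℕ → List J → Prop
  | 0, _ => True
  | k + 1, w => ∃ u v : List J, w = u ++ v ∧ (∀ j ∈ K, j ∈ u) ∧ HasBlocks K k v

theorem HasBlocks.of_sublist {K : Finset J} : ∀ {k : ℕ} {w w' : List J}, HasBlocks K k w →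
    w.Sublist w' → HasBlocks K k w'
  | 0, _, _, _, _ => trivial
  | k + 1, w, w', h, hs => by
    obtain ⟨u, v, rfl, hu, hv⟩ := h
    obtain ⟨u', v', rfl, hu', hv'⟩ := List.append_sublist_iff.1 hs
    exact ⟨u', v', rfl, fun j hj => hu'.subset (hu j hj), hv.of_sublist hv'⟩

theorem HasBlocks.pred {K : Finset J} {k : ℕ} {w : List J} (h : HasBlocks K (k + 1) w) :
    HasBlocks K k w := by
  obtain ⟨u, v, rfl, -, hv⟩ := h
  exact hv.of_sublist (List.sublist_append_right u v)

theorem HasBlocks.mono {K : Finset J} {k l : ℕ} {w : List J} (h : HasBlocks K l w)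
    (hkl : k ≤ l) : HasBlocks K k w := by
  induction l, hkl using Nat.le_induction with
  | base => exact h
  | succ l _ ih => exact ih h.pred

theorem HasBlocks.exists_split {K : Finset J} : ∀ {a b : ℕ} {w : List J}, HasBlocks K (a + b) w →
    ∃ u v, w = u ++ v ∧ HasBlocks K a u ∧ HasBlocks K b v
  | 0, b, w, h => ⟨[], w, rfl, trivial, by simpa using h⟩
  | a + 1, b, w, h => by
    rw [show a + 1 + b = (a + b) + 1 by omega] at h
    obtain ⟨u, v, rfl, hu, hv⟩ := h
    obtain ⟨u', v', rfl, hu', hv'⟩ := hv.exists_split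
    exact ⟨u ++ u', v', by simp, ⟨u, u', rfl, hu, hu'⟩, hv'⟩

/-- Cutting a word in two destroys at most one block. -/
theorem HasBlocks.of_append {K : Finset J} : ∀ {k : ℕ} {x y : List J}, HasBlocks K k (x ++ y) →
    ∃ a b, k ≤ a + b + 1 ∧ HasBlocks K a x ∧ HasBlocks K b y
  | 0, _, _, _ => ⟨0, 0, by omega, trivial, trivial⟩
  | k + 1, x, y, h => by
    obtain ⟨u, v, huv, hu, hv⟩ := h
    rcases List.append_eq_append_iff.1 huv with ⟨t, rfl, rfl⟩ | ⟨t, rfl, rfl⟩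
    · exact ⟨0, k, by omega, trivial, hv.of_sublist (List.sublist_append_right _ _)⟩
    · obtain ⟨a, b, hab, ha, hb⟩ := hv.of_append
      exact ⟨a + 1, b, by omega, ⟨u, t, rfl, hu, ha⟩, hb⟩

/-- The loss of three is one block for each of the two cuts and at most one inside the middle word.
-/
theorem HasBlocks.of_append₃ {K : Finset J} {k : ℕ} {x s y : List J}
    (h : HasBlocks K k (x ++ (s ++ y))) (hs : ¬ HasBlocks K 2 s) :
    ∃ a b, k ≤ a + b + 3 ∧ HasBlocks K a x ∧ HasBlocks K b y := by
  obtain ⟨a, c, hac, ha, hc⟩ := h.of_append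
  obtain ⟨d, b, hdb, hd, hb⟩ := hc.of_append
  have : d ≤ 1 := by
    by_contra! hcon
    exact hs (hd.mono hcon)
  exact ⟨a, b, by omega, ha, hb⟩

theorem HasBlocks.le_length {K : Finset J} (hK : K.Nonempty) : ∀ {k : ℕ} {w : List J},
    HasBlocks K k w → k ≤ w.length
  | 0, _, _ => Nat.zero_le _
  | k + 1, w, h => by
    obtain ⟨u, v, rfl, hu, hv⟩ := h
    obtain ⟨j, hj⟩ := hK
    have h1 : 0 < u.length := List.length_pos_of_mem (hu j hj)
    have h2 := hv.le_length ⟨j, hj⟩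
    simp only [List.length_append]
    omega

/-- A segment is a word which misses a letter of `K` or has only one letter. -/
def IsSegment (K : Finset J) (s : List J) : Prop := (∃ j ∈ K, j ∉ s) ∨ s.length = 1

theorem IsSegment.not_hasBlocks_two {K : Finset J} (hK : K.Nonempty) {s : List J}
    (hs : IsSegment K s) : ¬ HasBlocks K 2 s := by
  intro h
  rcases hs with ⟨j, hj, hjs⟩ | hs
  · obtain ⟨u, v, rfl, hu, -⟩ := h
    exact hjs (List.mem_append_left _ (hu j hj))
  · have := h.le_length hK
    omega

theorem exists_minimal_block (K : Finset J) {w : List J} (hK : K.Nonempty)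
    (hw : ∀ j ∈ K, j ∈ w) :
    ∃ (v : List J) (i : J) (t : List J), w = v ++ i :: t ∧ (∃ j ∈ K, j ∉ v) ∧
      ∀ j ∈ K, j ∈ v ++ [i] := by
  induction w using List.reverseRecOn with
  | nil =>
    obtain ⟨j, hj⟩ := hK
    exact absurd (hw j hj) (by simp)
  | append_singleton w i ih =>
    by_cases h : ∀ j ∈ K, j ∈ w
    · obtain ⟨v, i', t, rfl, h1, h2⟩ := ih h
      exact ⟨v, i', t ++ [i], by simp, h1, h2⟩
    · push Not at h
      exact ⟨w, i, [], rfl, h, hw⟩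

/-- A shortest prefix containing all of `K` yields two segments: its last letter, and what precedes
it, which misses a letter. At most `k` such prefixes split off, and the remainder is one more
segment. -/
theorem exists_segments (K : Finset J) (hK : K.Nonempty) : ∀ (k : ℕ) (w : List J),
    ¬ HasBlocks K (k + 1) w →
    ∃ S : List (List J), w = S.flatten ∧ S.length ≤ 2 * k + 1 ∧ ∀ s ∈ S, IsSegment K s := by
  intro k
  induction k with
  | zero =>
    intro w hw
    refine ⟨[w], by simp, by simp, ?_⟩
    simp only [List.mem_singleton, forall_eq]
    left
    by_contra! hcon
    exact hw ⟨w, [], by simp, hcon, trivial⟩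
  | succ k ih =>
    intro w hw
    by_cases hf : ∀ j ∈ K, j ∈ w
    · obtain ⟨v, i, t, rfl, hv, hvi⟩ := exists_minimal_block K hK hf
      have ht : ¬ HasBlocks K (k + 1) t := fun h => hw ⟨v ++ [i], t, by simp, hvi, h⟩
      obtain ⟨S, rfl, hSl, hS⟩ := ih t ht
      refine ⟨v :: [i] :: S, by simp, by simp only [List.length_cons]; omega, ?_⟩
      intro s hs
      rcases List.mem_cons.1 hs with rfl | hs
      · exact Or.inl hv
      rcases List.mem_cons.1 hs with rfl | hs
      · exact Or.inr rfl
      · exact hS s hs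
    · push Not at hf
      refine ⟨[w], by simp, by simp, ?_⟩
      simp only [List.mem_singleton, forall_eq]
      exact Or.inl hf

/-- `y` is `x` or arises from `x` by inserting one letter. -/
def InsertStep (x y : List J) : Prop :=
  x = y ∨ ∃ (u v : List J) (j : J), x = u ++ v ∧ y = u ++ j :: v

theorem InsertStep.sublist {x y : List J} (h : InsertStep x y) : x.Sublist y := by
  rcases h with rfl | ⟨u, v, j, rfl, rfl⟩
  · exact List.Sublist.refl _
  · exact List.Sublist.append (List.Sublist.refl _) (List.sublist_cons_self _ _)

theorem InsertStep.split {z x y : List J} (h : InsertStep z (x ++ y)) :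
    ∃ x' y', z = x' ++ y' ∧ ((InsertStep x' x ∧ y' = y) ∨ (x' = x ∧ InsertStep y' y)) := by
  rcases h with rfl | ⟨u, v, j, rfl, h⟩
  · exact ⟨x, y, rfl, Or.inl ⟨Or.inl rfl, rfl⟩⟩
  rcases List.append_eq_append_iff.1 h with ⟨t, rfl, rfl⟩ | ⟨t, rfl, ht⟩
  · exact ⟨x, t ++ v, by simp, Or.inr ⟨rfl, Or.inr ⟨t, v, j, rfl, rfl⟩⟩⟩
  · cases t with
    | nil =>
      exact ⟨u, v, rfl, Or.inr ⟨by simp, Or.inr ⟨[], v, j, rfl, by simpa using ht.symm⟩⟩⟩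
    | cons i t =>
      obtain ⟨rfl, rfl⟩ : j = i ∧ v = t ++ y := by simpa using ht
      exact ⟨u ++ t, y, by simp, Or.inl ⟨Or.inr ⟨u, t, j, rfl, rfl⟩, rfl⟩⟩

/-- The words `w 0, …, w m` arise from each other by insertions of letters. -/
def IsInsertChain (w : ℕ → List J) (m : ℕ) : Prop := ∀ i < m, InsertStep (w i) (w (i + 1))

theorem IsInsertChain.sublist {w : ℕ → List J} {m : ℕ} (h : IsInsertChain w m) {i k : ℕ}
    (hik : i ≤ k) (hk : k ≤ m) : (w i).Sublist (w k) := by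
  induction k, hik using Nat.le_induction with
  | base => exact List.Sublist.refl _
  | succ k _ ih => exact (ih (by omega)).trans (h k (by omega)).sublist

/-- A cut of the last word is traced back in time, each inserted letter lying on one side of it.
Since `InsertStep` admits equality, both sides are again chains on the same index set. -/
theorem IsInsertChain.exists_split : ∀ {m : ℕ} {w : ℕ → List J} {x y : List J},
    IsInsertChain w m → w m = x ++ y →
    ∃ a b : ℕ → List J, (∀ i ≤ m, w i = a i ++ b i) ∧ a m = x ∧ b m = y ∧
      IsInsertChain a m ∧ IsInsertChain b m ∧
      ∀ i < m, a i = a (i + 1) ∨ b i = b (i + 1)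
  | 0, w, x, y, _, hw => ⟨fun _ => x, fun _ => y, by
      intro i hi; obtain rfl : i = 0 := by omega
      exact hw, rfl, rfl, fun i hi => by omega, fun i hi => by omega, fun i hi => by omega⟩
  | m + 1, w, x, y, hc, hw => by
    have hstep := hc m (by omega)
    rw [hw] at hstep
    obtain ⟨x', y', hm, hxy⟩ := hstep.split
    obtain ⟨a, b, hab, rfl, rfl, hca, hcb, hor⟩ :=
      IsInsertChain.exists_split (m := m) (fun i hi => hc i (by omega)) hm
    refine ⟨fun i => if i ≤ m then a i else x, fun i => if i ≤ m then b i else y,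
      ?_, by simp, by simp, ?_, ?_, ?_⟩
    · intro i hi
      by_cases h : i ≤ m
      · simpa [h] using hab i h
      · obtain rfl : i = m + 1 := by omega
        simpa using hw
    · intro i hi
      by_cases h : i < m
      · simpa [h.le, Nat.succ_le_of_lt h] using hca i h
      · obtain rfl : i = m := by omega
        rcases hxy with ⟨h, -⟩ | ⟨h, -⟩
        · simpa using h
        · have h' : InsertStep (a i) x := Or.inl h
          simpa using h'
    · intro i hi
      by_cases h : i < m
      · simpa [h.le, Nat.succ_le_of_lt h] using hcb i h
      · obtain rfl : i = m := by omega
        rcases hxy with ⟨-, h⟩ | ⟨-, h⟩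
        · have h' : InsertStep (b i) y := Or.inl h
          simpa using h'
        · simpa using h
    · intro i hi
      by_cases h : i < m
      · simpa [h.le, Nat.succ_le_of_lt h] using hor i h
      · obtain rfl : i = m := by omega
        rcases hxy with ⟨-, h⟩ | ⟨h, -⟩
        · right; simpa using h
        · left; simpa using h

/-- Words that are extended again and again at the front converge to an infinite word read
from right to left. -/
theorem exists_limit_word {W t : ℕ → List J} (hW : ∀ k, W (k + 1) = t k ++ W k)
    (ht : ∀ k, t k ≠ []) :
    ∃ s : ℕ → J, (∀ k, ((List.range (W k).length).map s).reverse = W k) ∧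
      (∀ k, k ≤ (W k).length) ∧
      ∀ k, ∀ j ∈ t k, ∃ i, k ≤ i ∧ s i = j := by
  have hlen : ∀ k, k ≤ (W k).length := by
    intro k
    induction k with
    | zero => simp
    | succ k ih =>
      have := List.length_pos_iff.2 (ht k)
      rw [hW, List.length_append]
      omega
  have hpre : ∀ k l, k ≤ l → (W k).reverse <+: (W l).reverse := by
    intro k l hkl
    induction l, hkl using Nat.le_induction with
    | base => exact List.prefix_rfl
    | succ l _ ih =>
      rw [hW, List.reverse_append]
      exact ih.trans (List.prefix_append _ _)
  have hlt : ∀ i, i < ((W (i + 1)).reverse).length := fun i => by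
    have := hlen (i + 1)
    simp only [List.length_reverse]
    omega
  have key : ∀ k i (h : i < (W k).reverse.length),
      (W (i + 1)).reverse[i]'(hlt i) = (W k).reverse[i] := by
    intro k i h
    rcases le_total k (i + 1) with hk | hk
    · exact ((hpre _ _ hk).getElem h).symm
    · exact (hpre _ _ hk).getElem (hlt i)
  refine ⟨fun i => (W (i + 1)).reverse[i]'(hlt i), ?_, hlen, ?_⟩
  · intro k
    rw [← List.reverse_inj, List.reverse_reverse]
    apply List.ext_getElem
    · simp
    · intro i h1 h2
      simp only [List.getElem_map, List.getElem_range]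
      exact key k i h2
  · intro k j hj
    obtain ⟨i, hi, hij⟩ := List.getElem_of_mem (List.mem_reverse.2 hj)
    have hsplit : (W (k + 1)).reverse = (W k).reverse ++ (t k).reverse := by
      rw [hW, List.reverse_append]
    refine ⟨(W k).reverse.length + i, by have := hlen k; simp only [List.length_reverse]; omega, ?_⟩
    refine (key (k + 1) _ (by rw [hsplit, List.length_append]; omega)).trans ?_
    rw [← hij, List.getElem_of_eq hsplit, List.getElem_append_right (by omega)]
    simp

end Words

/-! ### Bounded and decaying products in a normed algebra -/

/-- The product of the word `w` under the letters `A`. -/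
def evalWord {J M : Type*} [Monoid M] (A : J → M) (w : List J) : M := (w.map A).prod

section Monoid

variable {J M : Type*} [Monoid M] (A : J → M)

@[simp] theorem evalWord_nil : evalWord A [] = 1 := rfl

@[simp] theorem evalWord_cons (j : J) (w : List J) : evalWord A (j :: w) = A j * evalWord A w := by
  simp [evalWord]

@[simp] theorem evalWord_append (u v : List J) :
    evalWord A (u ++ v) = evalWord A u * evalWord A v := by
  simp [evalWord]

theorem evalWord_commute {A : J → M} {q : M} {w : List J} (h : ∀ j ∈ w, Commute q (A j)) :
    Commute q (evalWord A w) := by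
  induction w with
  | nil => exact Commute.one_right q
  | cons j w ih =>
    rw [evalWord_cons]
    exact (h j (by simp)).mul_right (ih fun i hi => h i (by simp [hi]))

theorem evalWord_mul_eq_self {A : J → M} {x : M} {w : List J} (h : ∀ j ∈ w, A j * x = x) :
    evalWord A w * x = x := by
  induction w with
  | nil => simp
  | cons j w ih =>
    rw [evalWord_cons, mul_assoc, ih fun i hi => h i (by simp [hi]), h j (by simp)]

/-- All products in which the factors are added on the left one by one converge. -/
def LeftConvergent [TopologicalSpace M] : Prop :=
  ∀ s : ℕ → J, ∃ L : M, Tendsto (fun m => evalWord A ((List.range m).map s).reverse) atTop (𝓝 L)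

end Monoid

section Ring

variable {J M : Type*} [Ring M]

/-- `q` acts as a projection along the common fixed elements of the letters in `K`. -/
structure IsFixedComplement (A : J → M) (K : Finset J) (q : M) : Prop where
  commute : ∀ j ∈ K, Commute q (A j)
  fixed : ∀ j ∈ K, A j * (1 - q) = 1 - q
  mul_eq_zero : ∀ x, (∀ j ∈ K, A j * x = x) → q * x = 0

theorem IsFixedComplement.mul_self {A : J → M} {K : Finset J} {q : M}
    (hq : IsFixedComplement A K q) : q * q = q := by
  have := hq.mul_eq_zero (1 - q) hq.fixed
  rw [mul_sub, mul_one, sub_eq_zero] at this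
  exact this.symm

theorem IsFixedComplement.evalWord_mul {A : J → M} {K : Finset J} {q : M}
    (hq : IsFixedComplement A K q) {w : List J} (hw : ∀ j ∈ w, j ∈ K) :
    evalWord A w * q = evalWord A w - (1 - q) := by
  have := evalWord_mul_eq_self (A := A) fun j hj => hq.fixed j (hw j hj)
  rw [mul_sub, mul_one] at this
  rw [← this, sub_sub_cancel]

/-- Every word over `K` acts as the identity on `1 - q`, so the difference of two of them is
unchanged by a factor `q`. As `q` is idempotent and commutes with these words, it can be placed on
both outer factors, where decay applies. -/
theorem IsFixedComplement.mul_sub_mul {A : J → M} {K : Finset J} {q : M}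
    (hq : IsFixedComplement A K q) {x s s' y : List J} (hs : ∀ j ∈ s, j ∈ K)
    (hs' : ∀ j ∈ s', j ∈ K) (hy : ∀ j ∈ y, j ∈ K) :
    evalWord A x * (evalWord A s' - evalWord A s) * evalWord A y =
      evalWord A x * q * (evalWord A s' - evalWord A s) * (evalWord A y * q) := by
  set d := evalWord A s' - evalWord A s with hd
  have h1 : d * q = d := by
    rw [hd, sub_mul, hq.evalWord_mul hs, hq.evalWord_mul hs']
    abel
  have h2 : Commute q d := (evalWord_commute fun j hj => hq.commute j (hs' j hj)).sub_right
    (evalWord_commute fun j hj => hq.commute j (hs j hj))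
  have h3 : Commute q (evalWord A y) := evalWord_commute fun j hj => hq.commute j (hy j hj)
  rw [← h3.eq, mul_assoc _ q d, h2.eq, h1, mul_assoc _ d (q * _), ← mul_assoc d q, h1, mul_assoc]

end Ring

variable {J M : Type*} [NormedRing M] [NormedAlgebra ℝ M]

/-- The elements on which all the products of letters of `A` act boundedly. -/
def boundedPart (A : J → M) : Submodule ℝ M where
  carrier := {x | ∃ C, ∀ w, ‖evalWord A w * x‖ ≤ C}
  zero_mem' := ⟨0, fun w => by simp⟩
  add_mem' := by
    rintro x y ⟨C, hC⟩ ⟨D, hD⟩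
    refine ⟨C + D, fun w => ?_⟩
    rw [mul_add]
    exact (norm_add_le _ _).trans (add_le_add (hC w) (hD w))
  smul_mem' := by
    rintro c x ⟨C, hC⟩
    refine ⟨‖c‖ * C, fun w => ?_⟩
    rw [mul_smul_comm, norm_smul]
    exact mul_le_mul_of_nonneg_left (hC w) (norm_nonneg c)

theorem exists_bound_on_boundedPart [FiniteDimensional ℝ M] (A : J → M) :
    ∃ C, 0 ≤ C ∧ ∀ x ∈ boundedPart A, ∀ w, ‖evalWord A w * x‖ ≤ C * ‖x‖ := by
  have : CompleteSpace (boundedPart A) := FiniteDimensional.complete ℝ _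
  obtain ⟨C, hC⟩ := banach_steinhaus
    (g := fun w : List J => (ContinuousLinearMap.mul ℝ M (evalWord A w)).comp
      (boundedPart A).subtypeL) (by
      rintro ⟨x, C, hC⟩
      exact ⟨C, fun w => by simpa using hC w⟩)
  refine ⟨max C 0, le_max_right _ _, fun x hx w => ?_⟩
  have := ((ContinuousLinearMap.mul ℝ M (evalWord A w)).comp
      (boundedPart A).subtypeL).le_of_opNorm_le ((hC w).trans (le_max_left C 0)) ⟨x, hx⟩
  simpa using this

theorem exists_first_entry {A : J → M} {x : M} (hx : x ∉ boundedPart A) {w : List J}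
    (hw : evalWord A w * x ∈ boundedPart A) :
    ∃ (u : List J) (j : J) (v : List J), w = u ++ j :: v ∧ evalWord A v * x ∉ boundedPart A ∧
      evalWord A (j :: v) * x ∈ boundedPart A := by
  induction w with
  | nil => exact absurd (by simpa using hw) hx
  | cons j w ih =>
    by_cases h : evalWord A w * x ∈ boundedPart A
    · obtain ⟨u, i, v, rfl, h1, h2⟩ := ih h
      exact ⟨j :: u, i, v, rfl, h1, h2⟩
    · exact ⟨[], j, w, rfl, h, hw⟩

theorem exists_large_product [Finite J] [FiniteDimensional ℝ M] {A : J → M} {x : M}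
    (hx : x ∉ boundedPart A) (b : ℝ) :
    ∃ w, evalWord A w * x ∉ boundedPart A ∧ b < ‖evalWord A w * x‖ := by
  by_contra! hcon
  obtain ⟨C, hC0, hC⟩ := exists_bound_on_boundedPart A
  obtain ⟨c, hc⟩ := (Set.finite_range fun j => ‖A j‖).bddAbove
  have hc' : ∀ j, ‖A j‖ ≤ c := fun j => hc ⟨j, rfl⟩
  -- Outside `boundedPart` the bound is `b`. A word that enters it does so by one letter, costing a
  -- factor `c`, and from then on the uniform constant `C` applies.
  refine hx ⟨max b (C * (c * b)), fun w => ?_⟩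
  by_cases hw : evalWord A w * x ∈ boundedPart A
  · obtain ⟨u, j, v, rfl, hv, hjv⟩ := exists_first_entry hx hw
    refine le_max_of_le_right ?_
    rw [evalWord_append, mul_assoc]
    refine (hC _ hjv u).trans (mul_le_mul_of_nonneg_left ?_ hC0)
    rw [evalWord_cons, mul_assoc]
    exact (norm_mul_le _ _).trans (mul_le_mul (hc' j) (hcon v hv) (norm_nonneg _)
      ((norm_nonneg _).trans (hc' j)))
  · exact le_max_of_le_left (hcon w hw)

/-- The products of a finite left convergent family are uniformly bounded. -/
theorem LeftConvergent.exists_norm_le [Finite J] [FiniteDimensional ℝ M] {A : J → M}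
    (hA : LeftConvergent A) : ∃ B, 0 < B ∧ ∀ w, ‖evalWord A w‖ ≤ B := by
  suffices h : (1 : M) ∈ boundedPart A by
    obtain ⟨C, hC⟩ := h
    exact ⟨max C 1, by positivity, fun w => le_max_of_le_left (by simpa using hC w)⟩
  by_contra h1
  -- The first entry of the maximum makes the products unbounded; the second forces `t` to be
  -- nonempty.
  have step : ∀ p : ℕ × {W : List J // evalWord A W ∉ boundedPart A},
      ∃ t : List J, evalWord A (t ++ p.2.1) ∉ boundedPart A ∧
        max (p.1 : ℝ) ‖evalWord A p.2.1‖ < ‖evalWord A (t ++ p.2.1)‖ := by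
    intro p
    obtain ⟨t, h2, h3⟩ := exists_large_product p.2.2 (max (p.1 : ℝ) ‖evalWord A p.2.1‖)
    exact ⟨t, by simpa using h2, by simpa using h3⟩
  choose t ht1 ht2 using step
  let W : ℕ → {W : List J // evalWord A W ∉ boundedPart A} := fun k =>
    Nat.rec ⟨[], by simpa using h1⟩ (fun k p => ⟨t (k, p) ++ p.1, ht1 (k, p)⟩) k
  obtain ⟨s, hs, hlen, -⟩ := exists_limit_word (W := fun k => (W k).1) (t := fun k => t (k, W k))
    (fun k => rfl) (fun k hk => by
      have := ht2 (k, W k)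
      rw [hk] at this
      simp at this)
  obtain ⟨L, hL⟩ := hA s
  obtain ⟨C, hC⟩ := (Metric.isBounded_range_of_tendsto _ hL).exists_norm_le
  obtain ⟨k, hk⟩ := exists_nat_gt C
  have h3 := hC _ ⟨(W (k + 1)).1.length, rfl⟩
  simp only at h3
  rw [hs (k + 1)] at h3
  have h4 := ht2 (k, W k)
  have h5 : (k : ℝ) < ‖evalWord A (W (k + 1)).1‖ := (le_max_left _ _).trans_lt h4
  linarith

/-- Arbitrarily many blocks of letters of `K` do not make `x` smaller than `ε`. -/
def Persistent (A : J → M) (K : Finset J) (x : M) (ε : ℝ) : Prop :=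
  ∀ p, ∃ w : List J, (∀ j ∈ w, j ∈ K) ∧ HasBlocks K p w ∧ ε ≤ ‖evalWord A w * x‖

/-- For each `p` a witness splits as `u t` with `p` blocks in `u` and one in `t`. The vectors `A_t
x` are bounded, so along a subsequence they are nearly equal, and a single `t` serves all the words
`u` at the cost of `ε - ε'`. -/
theorem Persistent.step [FiniteDimensional ℝ M] {A : J → M} {K : Finset J} {B : ℝ}
    (hB0 : 0 < B) (hB : ∀ w, ‖evalWord A w‖ ≤ B) {x : M} {ε ε' : ℝ} (h : Persistent A K x ε)
    (hε : ε' < ε) :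
    ∃ t : List J, (∀ j ∈ t, j ∈ K) ∧ (∀ j ∈ K, j ∈ t) ∧ Persistent A K (evalWord A t * x) ε' := by
  have hex : ∀ p, ∃ u t : List J, (∀ j ∈ u, j ∈ K) ∧ (∀ j ∈ t, j ∈ K) ∧ HasBlocks K p u ∧
      (∀ j ∈ K, j ∈ t) ∧ ε ≤ ‖evalWord A u * (evalWord A t * x)‖ := by
    intro p
    obtain ⟨w, hwK, hw, hwx⟩ := h (p + 1)
    obtain ⟨u, t, rfl, hu, ht⟩ := hw.exists_split
    refine ⟨u, t, fun j hj => hwK j (by simp [hj]), fun j hj => hwK j (by simp [hj]), hu, ?_, ?_⟩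
    · obtain ⟨a, b, rfl, ha, -⟩ := ht
      exact fun j hj => List.mem_append_left _ (ha j hj)
    · simpa [mul_assoc] using hwx
  choose u t huK htK hu ht hx using hex
  have : ProperSpace M := FiniteDimensional.proper ℝ M
  have hmem : ∀ p, evalWord A (t p) * x ∈ Metric.closedBall (0 : M) (B * ‖x‖) := by
    intro p
    rw [mem_closedBall_zero_iff]
    exact (norm_mul_le _ _).trans (mul_le_mul_of_nonneg_right (hB _) (norm_nonneg _))
  obtain ⟨z, -, φ, hφ, hz⟩ := (isCompact_closedBall (0 : M) (B * ‖x‖)).tendsto_subseq hmem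
  have hδ : 0 < (ε - ε') / B := div_pos (by linarith) hB0
  obtain ⟨q₀, hq₀⟩ := Metric.cauchySeq_iff'.1 hz.cauchySeq _ hδ
  refine ⟨t (φ q₀), htK _, ht _, fun p => ?_⟩
  set q := max p q₀
  have hpq : p ≤ φ q := (le_max_left p q₀).trans (hφ.id_le q)
  refine ⟨u (φ q), huK _, (hu _).mono hpq, ?_⟩
  have h1 := hq₀ q (le_max_right _ _)
  rw [dist_eq_norm, lt_div_iff₀ hB0] at h1
  simp only [Function.comp] at h1
  have h2 : ‖evalWord A (u (φ q)) * (evalWord A (t (φ q)) * x - evalWord A (t (φ q₀)) * x)‖ ≤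
      ε - ε' := by
    refine (norm_mul_le _ _).trans ?_
    nlinarith [hB (u (φ q)), norm_nonneg (evalWord A (t (φ q)) * x - evalWord A (t (φ q₀)) * x)]
  rw [mul_sub] at h2
  have h3 := norm_sub_norm_le (evalWord A (u (φ q)) * (evalWord A (t (φ q)) * x))
    (evalWord A (u (φ q)) * (evalWord A (t (φ q₀)) * x))
  have h4 := hx (φ q)
  linarith

theorem not_persistent [Finite J] [FiniteDimensional ℝ M] {A : J → M} (hA : LeftConvergent A)
    {K : Finset J} (hK : K.Nonempty) {q : M} (hq : IsFixedComplement A K q) {ε : ℝ}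
    (hε : 0 < ε) : ¬ Persistent A K q ε := by
  intro h
  obtain ⟨B, hB0, hB⟩ := hA.exists_norm_le
  -- The thresholds start at `ε`, decrease strictly as `Persistent.step` demands, and stay above `ε
  -- / 2`.
  let e : ℕ → ℝ := fun k => ε / 2 + ε / 2 ^ (k + 1)
  have he : ∀ k, e (k + 1) < e k := by
    intro k
    have : ε / 2 ^ (k + 1 + 1) < ε / 2 ^ (k + 1) :=
      div_lt_div_of_pos_left hε (by positivity) (pow_lt_pow_right₀ (by norm_num) (by omega))
    simp only [e]
    linarith
  have step : ∀ (k : ℕ) (W : {W : List J // (∀ j ∈ W, j ∈ K) ∧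
      Persistent A K (evalWord A W * q) (e k)}),
      ∃ t : List J, (∀ j ∈ K, j ∈ t) ∧ (∀ j ∈ t ++ W.1, j ∈ K) ∧
        Persistent A K (evalWord A (t ++ W.1) * q) (e (k + 1)) := by
    intro k W
    obtain ⟨t, h1, h2, h3⟩ := W.2.2.step hB0 hB (he k)
    refine ⟨t, h2, ?_, by simpa [mul_assoc] using h3⟩
    intro j hj
    rcases List.mem_append.1 hj with hj | hj
    · exact h1 j hj
    · exact W.2.1 j hj
  choose t ht1 ht2 using step
  let W : ∀ k, {W : List J // (∀ j ∈ W, j ∈ K) ∧ Persistent A K (evalWord A W * q) (e k)} :=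
    fun k => Nat.rec ⟨[], by simp, by simpa [e] using h⟩
      (fun k p => ⟨t k p ++ p.1, ht2 k p⟩) k
  obtain ⟨s, hs, hlen, hmem⟩ := exists_limit_word (W := fun k => (W k).1)
    (t := fun k => t k (W k)) (fun k => rfl) (fun k hk => by
      obtain ⟨j, hj⟩ := hK
      have := ht1 k (W k) j hj
      rw [hk] at this
      simp at this)
  obtain ⟨L, hL⟩ := hA s
  have hfix : ∀ j ∈ K, A j * L = L := by
    intro j hj
    -- The difference tends to `A j * L - L` and vanishes whenever the next letter is `j`, which
    -- happens infinitely often.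
    have hlim := (hL.const_mul (A j)).sub (hL.comp (tendsto_add_atTop_nat 1))
    have hfreq : ∃ᶠ i in atTop, A j * evalWord A ((List.range i).map s).reverse -
        ((fun m => evalWord A ((List.range m).map s).reverse) ∘ fun a => a + 1) i ∈
        ({0} : Set M) := by
      rw [frequently_atTop]
      intro k
      obtain ⟨i, hki, hi⟩ := hmem k j (ht1 k (W k) j hj)
      refine ⟨i, hki, ?_⟩
      simp [List.range_succ, hi]
    have := isClosed_singleton.mem_of_frequently_of_tendsto hfreq hlim
    exact sub_eq_zero.1 this
  have hlenT : Tendsto (fun k => (W k).1.length) atTop atTop := tendsto_atTop_mono hlen tendsto_id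
  have hqL := (hL.comp hlenT).const_mul q
  rw [hq.mul_eq_zero L hfix] at hqL
  have hsmall := (tendsto_zero_iff_norm_tendsto_zero.1 hqL).eventually_lt_const
    (show 0 < ε / 2 / B by positivity)
  obtain ⟨k, hk⟩ := hsmall.exists
  simp only [Function.comp] at hk
  rw [hs k, (evalWord_commute fun j hj => hq.commute j ((W k).2.1 j hj)).eq,
    lt_div_iff₀ hB0] at hk
  obtain ⟨w, -, -, hw⟩ := (W k).2.2 0
  have h1 : ε / 2 ≤ e k := by
    simp only [e]
    have : 0 < ε / 2 ^ (k + 1) := by positivity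
    linarith
  have h2 := norm_mul_le (evalWord A w) (evalWord A (W k).1 * q)
  nlinarith [hB w, norm_nonneg (evalWord A (W k).1 * q)]

/-- Products decay geometrically in the number of blocks, away from the fixed elements. -/
theorem exists_decay [Finite J] [FiniteDimensional ℝ M] {A : J → M} (hA : LeftConvergent A)
    {K : Finset J} (hK : K.Nonempty) {q : M} (hq : IsFixedComplement A K q) :
    ∃ C r : ℝ, 0 < C ∧ 0 < r ∧ r < 1 ∧ ∀ (k : ℕ) (w : List J), (∀ j ∈ w, j ∈ K) →
      HasBlocks K k w → ‖evalWord A w * q‖ ≤ C * r ^ k := by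
  have hp := not_persistent hA hK hq (ε := 1 / 2) (by norm_num)
  simp only [Persistent, not_forall] at hp
  obtain ⟨p, hp⟩ := hp
  push Not at hp
  obtain ⟨B, hB0, hB⟩ := hA.exists_norm_le
  -- By Bernoulli `r ^ (p + 1) ≥ 1 / 2`, so the factor `1 / 2` gained from `p + 1` blocks is at most
  -- `r ^ (p + 1)`. The denominator in `C` covers words with fewer blocks.
  set r : ℝ := 1 - 1 / (2 * (p + 1)) with hr
  have hp0 : (0 : ℝ) < p + 1 := by positivity
  have hinv : 1 / (2 * ((p : ℝ) + 1)) ≤ 1 / 2 := by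
    apply one_div_le_one_div_of_le (by norm_num)
    have : (0 : ℝ) ≤ p := by positivity
    linarith
  have hinv0 : 0 < 1 / (2 * ((p : ℝ) + 1)) := by positivity
  have hr0 : 0 < r := by linarith
  have hr1 : r < 1 := by linarith
  have hbern : 1 / 2 ≤ r ^ (p + 1) := by
    have := one_add_mul_le_pow (a := -(1 / (2 * ((p : ℝ) + 1)))) (by linarith) (p + 1)
    have h2 : 1 + ((p + 1 : ℕ) : ℝ) * -(1 / (2 * ((p : ℝ) + 1))) = 1 / 2 := by
      push_cast
      field_simp
      ring
    rw [h2] at this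
    simpa [hr, sub_eq_add_neg] using this
  set C := B * (‖q‖ + 1) / r ^ (p + 1) with hC
  have hC0 : 0 < C := by positivity
  refine ⟨C, r, hC0, hr0, hr1, ?_⟩
  intro k
  induction k using Nat.strong_induction_on with
  | _ k ih =>
  intro w hwK hw
  rcases lt_or_ge k (p + 1) with hk | hk
  · have h1 : ‖evalWord A w * q‖ ≤ B * (‖q‖ + 1) :=
      (norm_mul_le _ _).trans (mul_le_mul (hB w) (by linarith) (norm_nonneg _) hB0.le)
    refine h1.trans ?_
    rw [hC, div_mul_eq_mul_div, le_div_iff₀ (by positivity)]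
    exact mul_le_mul_of_nonneg_left (pow_le_pow_of_le_one hr0.le hr1.le hk.le) (by positivity)
  · obtain ⟨l, rfl⟩ := Nat.exists_eq_add_of_le hk
    obtain ⟨u, v, rfl, hu, hv⟩ := hw.exists_split
    have huK : ∀ j ∈ u, j ∈ K := fun j hj => hwK j (by simp [hj])
    have hvK : ∀ j ∈ v, j ∈ K := fun j hj => hwK j (by simp [hj])
    have h1 := ih l (by omega) v hvK hv
    have h2 := hp u huK hu.pred
    have h3 : evalWord A (u ++ v) * q = (evalWord A u * q) * (evalWord A v * q) := by
      rw [evalWord_append, mul_assoc (evalWord A u) q, ← mul_assoc q,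
        (evalWord_commute fun j hj => hq.commute j (hvK j hj)).eq, mul_assoc _ q q, hq.mul_self,
        mul_assoc]
    rw [h3, pow_add]
    calc _ ≤ 1 / 2 * (C * r ^ l) := (norm_mul_le _ _).trans
          (mul_le_mul h2.le h1 (norm_nonneg _) (by norm_num))
      _ ≤ r ^ (p + 1) * (C * r ^ l) := mul_le_mul_of_nonneg_right hbern (by positivity)
      _ = C * (r ^ (p + 1) * r ^ l) := by ring

/-! ### Variation along chains of insertions -/

section Variation

variable {J M : Type*} [NormedRing M]

theorem sum_norm_sub_le_length {A : J → M} {B : ℝ} (hB : ∀ w, ‖evalWord A w‖ ≤ B)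
    {w : ℕ → List J} : ∀ {m : ℕ}, IsInsertChain w m →
    ∑ i ∈ Finset.range m, ‖evalWord A (w (i + 1)) - evalWord A (w i)‖ ≤ 2 * B * (w m).length
  | 0, _ => by
    have := (norm_nonneg _).trans (hB [])
    simp only [Finset.range_zero, Finset.sum_empty]
    positivity
  | m + 1, h => by
    have ih := sum_norm_sub_le_length hB (m := m) fun i hi => h i (by omega)
    rw [Finset.sum_range_succ]
    rcases h m (by omega) with he | ⟨u, v, j, hu, hv⟩
    · rw [← he]
      simpa using ih
    · have h1 : ((w (m + 1)).length : ℝ) = (w m).length + 1 := by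
        rw [hu, hv]
        simp only [List.length_append, List.length_cons]
        push_cast
        ring
      have h2 := norm_sub_le (evalWord A (w (m + 1))) (evalWord A (w m))
      have h3 := hB (w (m + 1))
      have h4 := hB (w m)
      rw [h1]
      linarith

theorem norm_mul_sub_mul_le {A : J → M} {K : Finset J} {q : M} (hq : IsFixedComplement A K q)
    {C r : ℝ} (hC : 0 < C) (hr : 0 < r) (hr1 : r < 1)
    (hdecay : ∀ (k : ℕ) (w : List J), (∀ j ∈ w, j ∈ K) → HasBlocks K k w →
      ‖evalWord A w * q‖ ≤ C * r ^ k)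
    {k : ℕ} {x s s' y : List J} (hK : ∀ j ∈ x ++ (s' ++ y), j ∈ K) (hs : ∀ j ∈ s, j ∈ K)
    (hk : HasBlocks K k (x ++ (s' ++ y))) (h2 : ¬ HasBlocks K 2 s') :
    ‖evalWord A x * (evalWord A s' - evalWord A s) * evalWord A y‖ ≤
      C ^ 2 * r ^ k / r ^ 3 * ‖evalWord A s' - evalWord A s‖ := by
  have hx : ∀ j ∈ x, j ∈ K := fun j hj => hK j (by simp [hj])
  have hs' : ∀ j ∈ s', j ∈ K := fun j hj => hK j (by simp [hj])
  have hy : ∀ j ∈ y, j ∈ K := fun j hj => hK j (by simp [hj])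
  obtain ⟨a, b, hab, ha, hb⟩ := hk.of_append₃ h2
  rw [hq.mul_sub_mul hs hs' hy]
  have h1 : C ^ 2 * r ^ (a + b) ≤ C ^ 2 * r ^ k / r ^ 3 := by
    rw [le_div_iff₀ (by positivity), mul_assoc, ← pow_add]
    exact mul_le_mul_of_nonneg_left (pow_le_pow_of_le_one hr.le hr1.le hab) (by positivity)
  calc _ ≤ ‖evalWord A x * q‖ * ‖evalWord A s' - evalWord A s‖ * ‖evalWord A y * q‖ :=
        (norm_mul_le _ _).trans (mul_le_mul_of_nonneg_right (norm_mul_le _ _) (norm_nonneg _))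
    _ ≤ (C * r ^ a) * ‖evalWord A s' - evalWord A s‖ * (C * r ^ b) := by
        gcongr
        · exact hdecay a x hx ha
        · exact hdecay b y hy hb
    _ = C ^ 2 * r ^ (a + b) * ‖evalWord A s' - evalWord A s‖ := by ring
    _ ≤ _ := mul_le_mul_of_nonneg_right h1 (norm_nonneg _)

/-- The contexts `P` and `Q` may vary with time so that the induction on `S` can absorb the first
segment into `P`. Blocks are required only at steps where `x` changes; at the other steps the
summand is zero. -/
theorem sum_le_of_segments {A : J → M} {K : Finset J} (hKn : K.Nonempty) {q : M}
    (hq : IsFixedComplement A K q) {C r V : ℝ} (hC : 0 < C) (hr : 0 < r) (hr1 : r < 1)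
    (hdecay : ∀ (k : ℕ) (w : List J), (∀ j ∈ w, j ∈ K) → HasBlocks K k w →
      ‖evalWord A w * q‖ ≤ C * r ^ k)
    (hV : ∀ (w : ℕ → List J) (m : ℕ), IsInsertChain w m → (∀ j ∈ w m, j ∈ K) →
      IsSegment K (w m) →
      ∑ i ∈ Finset.range m, ‖evalWord A (w (i + 1)) - evalWord A (w i)‖ ≤ V)
    (k m : ℕ) : ∀ (S : List (List J)) (x P Q : ℕ → List J), (∀ s ∈ S, IsSegment K s) →
      IsInsertChain x m → x m = S.flatten → (∀ j ∈ x m, j ∈ K) →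
      (∀ i < m, x i ≠ x (i + 1) → HasBlocks K k (P i ++ (x (i + 1) ++ Q i)) ∧
        ∀ j ∈ P i ++ (x (i + 1) ++ Q i), j ∈ K) →
      ∑ i ∈ Finset.range m, ‖evalWord A (P i) * (evalWord A (x (i + 1)) - evalWord A (x i)) *
        evalWord A (Q i)‖ ≤ S.length * (C ^ 2 * r ^ k / r ^ 3 * V) := by
  intro S
  induction S with
  | nil =>
    intro x P Q _ hx hm _ _
    have hnil : ∀ i ≤ m, x i = [] := by
      intro i hi
      have := hx.sublist hi le_rfl
      rw [hm] at this
      simpa using this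
    rw [Finset.sum_eq_zero]
    · simp
    · intro i hi
      have hi := Finset.mem_range.1 hi
      simp [hnil i hi.le, hnil (i + 1) hi]
  | cons s S ih =>
    intro x P Q hS hx hm hxK hP
    rw [List.flatten_cons] at hm
    obtain ⟨a, b, hab, ham, hbm, hca, hcb, hor⟩ := hx.exists_split hm
    have haK : ∀ i ≤ m, ∀ j ∈ a i, j ∈ K := fun i hi j hj => hxK j (by
      rw [hm, ← ham]
      exact List.mem_append_left _ ((hca.sublist hi le_rfl).subset hj))
    have hbK : ∀ j ∈ b m, j ∈ K := fun j hj => hxK j (by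
      rw [hm, ← hbm]
      exact List.mem_append_right _ hj)
    have hsa := hS s (by simp)
    have h1 : ∀ i ∈ Finset.range m,
        ‖evalWord A (P i) * (evalWord A (x (i + 1)) - evalWord A (x i)) * evalWord A (Q i)‖ ≤
        C ^ 2 * r ^ k / r ^ 3 * ‖evalWord A (a (i + 1)) - evalWord A (a i)‖ +
        ‖evalWord A (P i ++ a i) * (evalWord A (b (i + 1)) - evalWord A (b i)) *
          evalWord A (Q i)‖ := by
      intro i hi
      have hi := Finset.mem_range.1 hi
      rw [hab i hi.le, hab (i + 1) hi]
      rcases hor i hi with h | h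
      · rw [← h]
        simp only [evalWord_append, sub_self, norm_zero, mul_zero, zero_add]
        rw [← mul_sub, ← mul_assoc]
      · by_cases ha : a i = a (i + 1)
        · simp [ha, h]
        · rw [← h]
          obtain ⟨hb1, hb2⟩ := hP i hi (by rw [hab i hi.le, hab (i + 1) hi, h]; simpa using ha)
          rw [hab (i + 1) hi, ← h, List.append_assoc] at hb1 hb2
          have hn : ¬ HasBlocks K 2 (a (i + 1)) := fun hcon =>
            hsa.not_hasBlocks_two hKn (ham ▸ hcon.of_sublist (hca.sublist hi le_rfl))
          have := norm_mul_sub_mul_le hq hC hr hr1 hdecay hb2 (haK i hi.le) hb1 hn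
          simp only [evalWord_append, sub_self, norm_zero, mul_zero, zero_mul, add_zero] at this ⊢
          rw [← sub_mul, ← mul_assoc, mul_assoc (_ * _)]
          exact this
    refine (Finset.sum_le_sum h1).trans ?_
    rw [Finset.sum_add_distrib, ← Finset.mul_sum, List.length_cons]
    have h2 := hV a m hca (haK m le_rfl) (ham ▸ hsa)
    have h3 := ih b (fun i => P i ++ a i) Q (fun t ht => hS t (by simp [ht])) hcb hbm hbK (by
      intro i hi hb
      have ha : a i = a (i + 1) := (hor i hi).resolve_right hb
      have := hP i hi (by rw [hab i hi.le, hab (i + 1) hi, ha]; simpa using hb)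
      rw [hab (i + 1) hi, ← ha] at this
      simpa using this)
    have h4 := mul_le_mul_of_nonneg_left h2 (show 0 ≤ C ^ 2 * r ^ k / r ^ 3 by positivity)
    push_cast
    linarith

theorem sum_le_sum_stages {A : J → M} {K : Finset J} (hKn : K.Nonempty) {q : M}
    (hq : IsFixedComplement A K q) {C r V : ℝ} (hC : 0 < C) (hr : 0 < r) (hr1 : r < 1)
    (hV0 : 0 ≤ V)
    (hdecay : ∀ (k : ℕ) (w : List J), (∀ j ∈ w, j ∈ K) → HasBlocks K k w →
      ‖evalWord A w * q‖ ≤ C * r ^ k)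
    (hV : ∀ (w : ℕ → List J) (m : ℕ), IsInsertChain w m → (∀ j ∈ w m, j ∈ K) →
      IsSegment K (w m) →
      ∑ i ∈ Finset.range m, ‖evalWord A (w (i + 1)) - evalWord A (w i)‖ ≤ V) :
    ∀ (k m : ℕ) (w : ℕ → List J), IsInsertChain w m → (∀ j ∈ w m, j ∈ K) →
      ¬ HasBlocks K (k + 1) (w m) →
      ∑ i ∈ Finset.range m, ‖evalWord A (w (i + 1)) - evalWord A (w i)‖ ≤
        ∑ l ∈ Finset.range (k + 1), (2 * l + 1) * (C ^ 2 * r ^ l / r ^ 3 * V) := by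
  have stage : ∀ (k m : ℕ) (w : ℕ → List J), IsInsertChain w m → (∀ j ∈ w m, j ∈ K) →
      ¬ HasBlocks K (k + 1) (w m) → (∀ i < m, HasBlocks K k (w (i + 1))) →
      ∑ i ∈ Finset.range m, ‖evalWord A (w (i + 1)) - evalWord A (w i)‖ ≤
        (2 * k + 1) * (C ^ 2 * r ^ k / r ^ 3 * V) := by
    intro k m w hw hK hk hblocks
    obtain ⟨S, hS, hSl, hseg⟩ := exists_segments K hKn k _ hk
    have h1 := sum_le_of_segments hKn hq hC hr hr1 hdecay hV k m S w (fun _ => []) (fun _ => [])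
      hseg hw hS hK (fun i hi _ => ⟨by simpa using hblocks i hi, fun j hj =>
        hK j ((hw.sublist hi le_rfl).subset (by simpa using hj))⟩)
    simp only [evalWord_nil, one_mul, mul_one] at h1
    refine h1.trans (mul_le_mul_of_nonneg_right (by exact_mod_cast hSl) (by positivity))
  intro k
  induction k with
  | zero =>
    intro m w hw hK hk
    simpa using stage 0 m w hw hK hk fun i _ => trivial
  | succ k ih =>
    intro m w hw hK hk
    rw [Finset.sum_range_succ]
    by_cases h0 : HasBlocks K (k + 1) (w 0)
    · have := stage (k + 1) m w hw hK hk fun i hi =>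
        h0.of_sublist (hw.sublist (Nat.zero_le _) hi)
      refine this.trans (le_add_of_nonneg_left (Finset.sum_nonneg fun l _ => by positivity))
    · classical
      -- `n` is the last time with at most `k` blocks. The step leaving it belongs to the later
      -- stage, since a stage counts blocks after the insertion.
      obtain ⟨n, hnm, hn1, hn2⟩ : ∃ n ≤ m, ¬ HasBlocks K (k + 1) (w n) ∧
          ∀ i, n < i → i ≤ m → HasBlocks K (k + 1) (w i) :=
        ⟨Nat.findGreatest (fun i => ¬ HasBlocks K (k + 1) (w i)) m, Nat.findGreatest_le m,
          Nat.findGreatest_spec (P := fun i => ¬ HasBlocks K (k + 1) (w i)) (Nat.zero_le m) h0,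
          fun i h1 h2 => not_not.1 (Nat.findGreatest_is_greatest h1 h2)⟩
      obtain ⟨d, rfl⟩ := Nat.exists_eq_add_of_le hnm
      rw [Finset.sum_range_add]
      refine add_le_add ?_ ?_
      · exact ih n w (fun i hi => hw i (by omega))
          (fun j hj => hK j ((hw.sublist hnm le_rfl).subset hj)) hn1
      · exact stage (k + 1) d (fun i => w (n + i)) (fun i hi => hw (n + i) (by omega)) hK hk
          fun i hi => hn2 (n + (i + 1)) (by omega) (by omega)

variable [NormedAlgebra ℝ M]

/-- The variation along chains of insertions of letters of `K` is uniformly bounded. -/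
theorem exists_variation_bound [Finite J] [FiniteDimensional ℝ M] {A : J → M}
    (hA : LeftConvergent A) (hq : ∀ K : Finset J, ∃ q, IsFixedComplement A K q) (K : Finset J) :
    ∃ V, 0 ≤ V ∧ ∀ (w : ℕ → List J) (m : ℕ), IsInsertChain w m → (∀ j ∈ w m, j ∈ K) →
      ∑ i ∈ Finset.range m, ‖evalWord A (w (i + 1)) - evalWord A (w i)‖ ≤ V := by
  classical
  induction K using Finset.strongInduction with
  | H K ih =>
  obtain ⟨B, hB0, hB⟩ := hA.exists_norm_le
  rcases K.eq_empty_or_nonempty with rfl | hKn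
  · refine ⟨0, le_rfl, fun w m hw hK => ?_⟩
    have hnil : w m = [] := List.eq_nil_iff_forall_not_mem.2 fun j hj => by simpa using hK j hj
    simpa [hnil] using sum_norm_sub_le_length hB hw
  have ih' : ∀ j, ∃ V, 0 ≤ V ∧ (j ∈ K → ∀ (w : ℕ → List J) (m : ℕ), IsInsertChain w m →
      (∀ i ∈ w m, i ∈ K.erase j) →
      ∑ i ∈ Finset.range m, ‖evalWord A (w (i + 1)) - evalWord A (w i)‖ ≤ V) := by
    intro j
    by_cases hj : j ∈ K
    · obtain ⟨V, h0, hV⟩ := ih _ (Finset.erase_ssubset hj)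
      exact ⟨V, h0, fun _ => hV⟩
    · exact ⟨0, le_rfl, fun h => absurd h hj⟩
  choose U hU0 hU using ih'
  have hUs : 0 ≤ ∑ j ∈ K, U j := Finset.sum_nonneg fun j _ => hU0 j
  -- The sum handles segments missing some letter `j`, and `2 * B` those of length one.
  set V := ∑ j ∈ K, U j + 2 * B with hVdef
  have hV0 : 0 ≤ V := by positivity
  have hV : ∀ (w : ℕ → List J) (m : ℕ), IsInsertChain w m → (∀ j ∈ w m, j ∈ K) →
      IsSegment K (w m) →
      ∑ i ∈ Finset.range m, ‖evalWord A (w (i + 1)) - evalWord A (w i)‖ ≤ V := by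
    intro w m hw hK hseg
    rcases hseg with ⟨j, hj, hjw⟩ | hlen
    · have h1 := hU j hj w m hw fun i hi =>
        Finset.mem_erase.2 ⟨fun h => hjw (h ▸ hi), hK i hi⟩
      have h2 := Finset.single_le_sum (fun j _ => hU0 j) hj
      linarith
    · have h1 := sum_norm_sub_le_length hB hw
      rw [hlen] at h1
      push_cast at h1
      linarith
  obtain ⟨q, hq⟩ := hq K
  obtain ⟨C, r, hC, hr, hr1, hdecay⟩ := exists_decay hA hKn hq
  have hsum : Summable fun l : ℕ => (2 * (l : ℝ) + 1) * (C ^ 2 * r ^ l / r ^ 3 * V) := by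
    have hrn : ‖r‖ < 1 := by rwa [Real.norm_of_nonneg hr.le]
    have h1 := ((summable_pow_mul_geometric_of_norm_lt_one 1 hrn).mul_left 2).add
      (summable_geometric_of_norm_lt_one hrn)
    refine (h1.mul_left (C ^ 2 / r ^ 3 * V)).congr fun l => ?_
    ring
  refine ⟨∑' l : ℕ, (2 * (l : ℝ) + 1) * (C ^ 2 * r ^ l / r ^ 3 * V),
    tsum_nonneg fun l => by positivity, fun w m hw hK => ?_⟩
  -- A word has no more blocks than letters, so its length bounds the number of stages.
  refine (sum_le_sum_stages hKn hq hC hr hr1 hV0 hdecay hV (w m).length m w hw hK ?_).trans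
    (hsum.sum_le_tsum _ fun l _ => by positivity)
  intro h
  have := h.le_length hKn
  omega

end Variation

/-! ### Matrices -/

section Matrices

variable {J : Type*} {n : ℕ} {A : J → Matrix (Fin n) (Fin n) ℝ}

theorem leftProd_eq_evalWord (A : J → Matrix (Fin n) (Fin n) ℝ) (s : ℕ → J) (m : ℕ) :
    leftProd A s m = evalWord A ((List.range m).map s).reverse := by
  induction m with
  | zero => rfl
  | succ m ih => simp [leftProd, ih, List.range_succ]

theorem mem_nullPart {K : Set J} {v : Fin n → ℝ} :
    v ∈ nullPart A K ↔ ∀ j ∈ K, Matrix.toLin' (A j) v = v := by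
  simp only [nullPart, Submodule.mem_iInf, LinearMap.mem_ker, map_sub, Matrix.toLin'_one,
    LinearMap.sub_apply, LinearMap.id_apply, sub_eq_zero]
  exact forall₂_congr fun _ _ => eq_comm

theorem sub_apply_mem_rangePart {K : Set J} {j : J} (hj : j ∈ K) (v : Fin n → ℝ) :
    v - Matrix.toLin' (A j) v ∈ rangePart A K := by
  refine Submodule.mem_iSup_of_mem j (Submodule.mem_iSup_of_mem hj ⟨v, ?_⟩)
  simp

/-- The projection onto the range part along the null part works: each `A_j` fixes the null part
pointwise and preserves the range part, because `v - A_j v` lies there. Hence it commutes with the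
projection. -/
theorem IsTransversal.exists_isFixedComplement (hA : IsTransversal A) (K : Finset J) :
    ∃ q, IsFixedComplement A K q := by
  have hc := (hA (K : Set J)).symm
  set N := nullPart A (K : Set J)
  set R := rangePart A (K : Set J)
  set p := R.projection N hc
  have hsub : ∀ v, v - p v ∈ N := fun v => by
    rw [← Submodule.projection_eq_self_sub_projection hc]
    exact Submodule.projection_apply_mem _ _
  have hcomm : ∀ j ∈ K, ∀ v, p (Matrix.toLin' (A j) v) = Matrix.toLin' (A j) (p v) := by
    intro j hj v
    have h1 : Matrix.toLin' (A j) v = (v - p v) + Matrix.toLin' (A j) (p v) := by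
      rw [← mem_nullPart.1 (hsub v) j hj, ← map_add, sub_add_cancel]
    have h2 : Matrix.toLin' (A j) (p v) ∈ R := by
      have := R.sub_mem (Submodule.projection_apply_mem hc v)
        (sub_apply_mem_rangePart (A := A) (K := K) hj (p v))
      rwa [sub_sub_cancel] at this
    rw [h1, map_add, Submodule.projection_apply_of_mem_right hc (hsub v), zero_add,
      Submodule.projection_apply_of_mem_left hc h2]
  refine ⟨LinearMap.toMatrix' p, ?_, ?_, ?_⟩
  · intro j hj
    apply Matrix.toLin'.injective
    refine LinearMap.ext fun v => ?_
    rw [Matrix.toLin'_mul, Matrix.toLin'_mul, Matrix.toLin'_toMatrix']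
    exact hcomm j hj v
  · intro j hj
    apply Matrix.toLin'.injective
    refine LinearMap.ext fun v => ?_
    rw [Matrix.toLin'_mul, map_sub, Matrix.toLin'_toMatrix', Matrix.toLin'_one, LinearMap.comp_apply,
      LinearMap.sub_apply, LinearMap.id_apply]
    exact mem_nullPart.1 (hsub v) j hj
  · intro x hx
    apply Matrix.toLin'.injective
    refine LinearMap.ext fun v => ?_
    rw [Matrix.toLin'_mul, Matrix.toLin'_toMatrix', map_zero]
    refine Submodule.projection_apply_of_mem_right hc ?_
    refine mem_nullPart.2 fun j hj => ?_
    have h := congrArg (fun y => Matrix.toLin' y v) (hx j hj)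
    simpa only [Matrix.toLin'_mul, LinearMap.comp_apply] using h

theorem exists_seminorm_le_mul_norm {E : Type*} [NormedAddCommGroup E] [NormedSpace ℝ E]
    [FiniteDimensional ℝ E] (N : Seminorm ℝ E) : ∃ c, 0 ≤ c ∧ ∀ x, N x ≤ c * ‖x‖ := by
  let b := Module.finBasis ℝ E
  let f := fun i => (LinearMap.toContinuousLinearMap (b.coord i))
  refine ⟨∑ i, ‖f i‖ * N (b i), by positivity, fun x => ?_⟩
  have h1 : N (∑ i, b.repr x i • b i) ≤ ∑ i, N (b.repr x i • b i) :=
    Finset.le_sum_of_subadditive N (map_zero N).le (map_add_le_add N) _ _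
  rw [b.sum_repr x] at h1
  refine h1.trans ?_
  rw [Finset.sum_mul]
  refine Finset.sum_le_sum fun i _ => ?_
  rw [map_smul_eq_mul, mul_right_comm]
  exact mul_le_mul_of_nonneg_right ((f i).le_opNorm x) (apply_nonneg N _)

theorem IsInsertionSequence.isInsertChain {w : ℕ → List J} (hw : IsInsertionSequence w) (m : ℕ) :
    IsInsertChain (fun i => w (i + 1)) m :=
  fun i _ => Or.inr (hw.step (i + 1) (by omega))

end Matrices

end MatrixFamily

/-- The variation of the products along insertion sequences over a finite CP family is uniformly
bounded, with respect to any norm `N` on matrices. The series runs over the indices `i + 1 ≥ 1`. -/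
theorem theorem5p2 {J : Type*} [Finite J] {n : ℕ} (A : J → Matrix (Fin n) (Fin n) ℝ)
    (hA : MatrixFamily.IsCP A)
    (N : Seminorm ℝ (Matrix (Fin n) (Fin n) ℝ)) (hN : ∀ X, N X = 0 → X = 0) :
    ∃ V : ℝ, ∀ w : ℕ → List J, MatrixFamily.IsInsertionSequence w →
      Summable (fun i : ℕ => N (MatrixFamily.wordProd A (w (i + 1 + 1)) -
        MatrixFamily.wordProd A (w (i + 1)))) ∧
      ∑' i : ℕ, N (MatrixFamily.wordProd A (w (i + 1 + 1)) -
        MatrixFamily.wordProd A (w (i + 1))) ≤ V := by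
  cases nonempty_fintype J
  -- The argument needs a submultiplicative norm, which `N` need not be; `N` is compared with this
  -- one at the end, through the constant `c`.
  let _ := Matrix.linftyOpNormedRing (n := Fin n) (α := ℝ)
  let _ := Matrix.linftyOpNormedAlgebra (R := ℝ) (n := Fin n) (α := ℝ)
  have hconv : MatrixFamily.LeftConvergent A := by
    intro s
    obtain ⟨L, hL⟩ := hA.lcp s
    exact ⟨L, hL.congr fun m => MatrixFamily.leftProd_eq_evalWord A s m⟩
  obtain ⟨V, hV0, hV⟩ := MatrixFamily.exists_variation_bound hconv
    hA.transversal.exists_isFixedComplement Finset.univ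
  obtain ⟨c, hc0, hc⟩ := MatrixFamily.exists_seminorm_le_mul_norm N
  refine ⟨c * V, fun w hw => ?_⟩
  have hsum : ∀ m, ∑ i ∈ Finset.range m, N (MatrixFamily.wordProd A (w (i + 1 + 1)) -
      MatrixFamily.wordProd A (w (i + 1))) ≤ c * V := by
    intro m
    refine (Finset.sum_le_sum fun i _ => hc _).trans ?_
    rw [← Finset.mul_sum]
    exact mul_le_mul_of_nonneg_left
      (hV (fun i => w (i + 1)) m (hw.isInsertChain m) fun j _ => Finset.mem_univ j) hc0
  exact ⟨summable_of_sum_range_le (fun i => apply_nonneg N _) hsum,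
    Real.tsum_le_of_sum_range_le (fun i => apply_nonneg N _) hsum⟩
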